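/- Let $\mathsf{Diff}_2^*$ be the set of partitions whose consecutive parts differ by at least two and which have no part equal to $1$. For $\lambda=(\lambda_1\ge\lambda_2\ge\cdots\ge\lambda_m)\in \mathsf{Diff}_2^*$, let $col^*(\lambda)$ be the partition formed by the columns of the Ferrers diagram of $(\lambda_1-2m,\lambda_2-2(m-1),\ldots,\lambda_m-2)$, i.e. the conjugate of that partition (zero entries being ignored). Write $2^a1^b$ for the partition with exactly $a$ parts equal to $2$, $b$ parts equal to $1$, and no other parts; a condition of the form $col^*(\lambda)=2^a1^b$, or one prescribing the number of $1$'s, is understood not to be satisfied if a prescribed multiplicity is negative. For all integers $N\ge 1$ and $k,j,\ell\ge 0$, the number of partitions of $N$ into parts congruent to $2$ or $3$ modulo $5$ with exactly $k$ $2$'s, $j$ $3$'s and $\ell$ $7$'s is equal to the number of partitions $\lambda\in\mathsf{Diff}_2^*$ of $N$ such that: 1. if $\lambda$ has at least seven parts, then $col^*(\lambda)$ has exactly $k$ $2$'s, $j$ $3$'s and $\ell$ $7$'s; 2. if $\lambda$ has four, five or six parts, then $col^*(\lambda)$ has exactly $k$ $2$'s and $j$ $3$'s, and between $7\ell$ and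 $7\ell+6$ (inclusive) $1$'s; 3. if $\lambda$ has three parts, then $col^*(\lambda)$ has exactly $k$ $2$'s and $j$ $3$'s, and its number of $1$'s is one of $7\ell$, $7\ell+1$, $7\ell-12$, $7\ell-4$, $7\ell+4$, $7\ell+5$, $7\ell+6$; 4. if $\lambda$ has two parts, then either (a) $\ell=0$ and $col^*(\lambda)=2^k1^{3(j-2)}$ (which requires $j\ge 2$) or $col^*(\lambda)=2^k1^{3j+2}$, or (b) $\ell=1$ and $col^*(\lambda)=2^k1^{3j+1}$; 5. if $\lambda$ has one part, then either (a) $k\ge 1$, $j=\ell=0$ and $col^*(\lambda)=1^{2k-2}$, or (b) $j=1$, $\ell=0$ and $col^*(\lambda)=1^{2k+1}$. -/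

import Mathlib

namespace RogersRamanujan

/-- The parts `λ₁ ≥ λ₂ ≥ ⋯ ≥ λₘ` of a partition, listed in weakly decreasing order. -/
def rowList {N : ℕ} (lam : N.Partition) : List ℕ :=
  lam.parts.sort (· ≥ ·)

/-- `Diff₂`: consecutive parts differ by at least two. -/
def IsDiffTwo {N : ℕ} (lam : N.Partition) : Prop :=
  (rowList lam).IsChain (fun a b => b + 2 ≤ a)

/-- `Diff₂^*`: partitions in `Diff₂` with no part equal to `1`. -/
def IsDiffTwoStar {N : ℕ} (lam : N.Partition) : Prop :=
  IsDiffTwo lam ∧ 1 ∉ lam.parts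

/-- The lengths of the (non-empty) columns of the Ferrers diagram whose rows have lengths `rows`:
the columns are indexed by `0 ≤ c < max rows`, and column `c` meets the rows of length `> c`. -/
def columns (rows : List ℕ) : Multiset ℕ :=
  (Multiset.range (rows.foldr max 0)).map (fun c => rows.countP (fun r => c < r))

/-- `(λ₁ - 2m, λ₂ - 2(m-1), …, λₘ - 2)`. With the index `i` starting at `0`, the entry at `i` is
`λ_{i+1} - 2(m - i)`; for `λ ∈ Diff₂^*` every one of these differences is a non-negative integer. -/
def reducedRows {N : ℕ} (lam : N.Partition) : List ℕ :=
  (rowList lam).mapIdx (fun i a => a - 2 * ((rowList lam).length - i))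

/-- `col^*(λ)`, the multiset of parts of the partition formed by the columns of
`(λ₁ - 2m, …, λₘ - 2)`. -/
def colStar {N : ℕ} (lam : N.Partition) : Multiset ℕ :=
  columns (reducedRows lam)

/-- The conditions on `λ`, according to its number of parts. -/
def Admissible (k j l : ℕ) {N : ℕ} (lam : N.Partition) : Prop :=
  (7 ≤ lam.parts.card →
    (colStar lam).count 2 = k ∧ (colStar lam).count 3 = j ∧ (colStar lam).count 7 = l) ∧
  (4 ≤ lam.parts.card ∧ lam.parts.card ≤ 6 →
    (colStar lam).count 2 = k ∧ (colStar lam).count 3 = j ∧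
      7 * l ≤ (colStar lam).count 1 ∧ (colStar lam).count 1 ≤ 7 * l + 6) ∧
  (lam.parts.card = 3 →
    (colStar lam).count 2 = k ∧ (colStar lam).count 3 = j ∧
      (((colStar lam).count 1 : ℤ) = 7 * (l : ℤ) ∨
       ((colStar lam).count 1 : ℤ) = 7 * (l : ℤ) + 1 ∨
       ((colStar lam).count 1 : ℤ) = 7 * (l : ℤ) - 12 ∨
       ((colStar lam).count 1 : ℤ) = 7 * (l : ℤ) - 4 ∨
       ((colStar lam).count 1 : ℤ) = 7 * (l : ℤ) + 4 ∨
       ((colStar lam).count 1 : ℤ) = 7 * (l : ℤ) + 5 ∨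
       ((colStar lam).count 1 : ℤ) = 7 * (l : ℤ) + 6)) ∧
  (lam.parts.card = 2 →
    (l = 0 ∧ ((2 ≤ j ∧
        colStar lam = Multiset.replicate k 2 + Multiset.replicate (3 * (j - 2)) 1) ∨
      colStar lam = Multiset.replicate k 2 + Multiset.replicate (3 * j + 2) 1)) ∨
    (l = 1 ∧ colStar lam = Multiset.replicate k 2 + Multiset.replicate (3 * j + 1) 1)) ∧
  (lam.parts.card = 1 →
    (1 ≤ k ∧ j = 0 ∧ l = 0 ∧ colStar lam = Multiset.replicate (2 * k - 2) 1) ∨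
    (j = 1 ∧ l = 0 ∧ colStar lam = Multiset.replicate (2 * k + 1) 1))

end RogersRamanujan

/-! Sort `Diff₂^*` by the number m of parts. Removing 2, 4, …, 2m from the parts and conjugating
leaves an arbitrary multiset of parts in [1, m] and lowers the sum by m(m+1) (`card_isDiffTwoStar`).
The conditions on col^* then prescribe multiplicities, so the generating function is a product with
one factor per part size (`card_isPrescribed`).

On the other side, fixing the multiplicities of 2, 3, 7 multiplies ∏ 1/(1 - X^i), i ≡ 2, 3 mod 5, by
w = X^(2k+3j+7l) (1-X²)(1-X³)(1-X⁷). By the second Rogers–Ramanujan identity the result is ∑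
X^(m(m+1)) w/(X;X)_m, to be compared with the first count term by term. For m ≥ 7 the factors of w
cancel those of the parts 2, 3, 7. For 4 ≤ m ≤ 6 there is no part 7, but (1-X⁷)/(1-X) = 1 + ⋯ + X⁶
allows 7l to 7l+6 ones (`colGF_eq_of_four_le`). For m ≤ 3 the quotients are polynomials, with
negative coefficients when m ≤ 2; only their total over m = 0, …, 3 matches
(`small_parts_identity`), up to a constant that N ≥ 1 makes harmless.

The Rogers–Ramanujan identity is proved where q is nilpotent, so that infinite products and series
are finite. The series ∑ q^(m²+im)/(q;q)_m times (q^(i+1);q)_∞ and Rogers' series at z = q^i satisfy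
the same recurrence in i and both are 1 for large i (`rrSum_mul_qPoch`). At z = q Rogers' series
becomes a theta series, which the Jacobi triple product factors (`FiniteJacobi.limit`,
`rrSum_mul_eq_one`). -/

namespace RogersRamanujan

open Finset

/-! ### Rogers' series and the Rogers–Ramanujan recurrence -/

section Rogers

variable {S : Type*} [CommRing S]

/-- The finite `q`-shifted factorial `(a; q)_n`. -/
def qPoch (a q : S) (n : ℕ) : S := ∏ t ∈ range n, (1 - a * q ^ t)

lemma qPoch_zero (a q : S) : qPoch a q 0 = 1 := by simp [qPoch]

lemma qPoch_succ (a q : S) (n : ℕ) :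
    qPoch a q (n + 1) = qPoch a q n * (1 - a * q ^ n) := prod_range_succ _ _

lemma qPoch_succ' (a q : S) (n : ℕ) :
    qPoch a q (n + 1) = (1 - a) * qPoch (a * q) q n := by
  rw [qPoch, prod_range_succ', qPoch, mul_comm, pow_zero, mul_one]
  congr 1
  exact prod_congr rfl fun t _ => by ring

/-- `J n` is inverse to `(q; q)_n` for every `n`. -/
structure IsInvQFact (q : S) (J : ℕ → S) : Prop where
  zero : J 0 = 1
  succ : ∀ n, (1 - q ^ (n + 1)) * J (n + 1) = J n

lemma IsInvQFact.qPoch_mul {q : S} {J : ℕ → S} (h : IsInvQFact q J) (n : ℕ) :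
    qPoch q q n * J n = 1 := by
  induction n with
  | zero => simp [qPoch_zero, h.zero]
  | succ n ih =>
    rw [qPoch_succ]
    linear_combination ih + qPoch q q n * h.succ n

/-- The exponents `s (5 s - 1) / 2`. -/
def rogersExp : ℕ → ℕ
  | 0 => 0
  | s + 1 => rogersExp s + 5 * s + 2

/-- The terms, for `s ≥ 1` and with the index shifted by one, of Rogers' series. -/
def rogersTerm (q : S) (J : ℕ → S) (z : S) (s : ℕ) : S :=
  (-1) ^ (s + 1) * z ^ (2 * s + 2) * q ^ rogersExp (s + 1) * (1 - z * q ^ (2 * s + 2)) *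
    qPoch (z * q) q s * J (s + 1)

/-- Partial sums of Rogers' series. -/
def rogersSum (q : S) (J : ℕ → S) (z : S) (n : ℕ) : S :=
  1 + ∑ s ∈ range n, rogersTerm q J z s

/-- The truncation error carries the factor q^`rogersExp (n + 1)`, so the functional equation of the
full series holds exactly once q^n = 0. -/
lemma rogersSum_recurrence {q : S} {J : ℕ → S} (h : IsInvQFact q J) (z : S) (n : ℕ) :
    rogersSum q J z n - (1 - z * q) * rogersSum q J (z * q) n -
        z * q * (1 - z * q) * (1 - z * q ^ 2) * rogersSum q J (z * q ^ 2) n =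
      (-1) ^ n * z ^ (2 * n + 2) * q ^ (rogersExp n + 5 * n + 2) * qPoch (z * q) q n * J n *
        (1 + q ^ (n + 1) - z * q ^ (2 * n + 2)) := by
  induction n with
  | zero => simp [rogersSum, rogersExp, qPoch_zero, h.zero]; ring
  | succ n ih =>
    -- The prefactors 1 - zq and 1 - zq² complete the shifted factorials, so all three new terms
    -- become multiples of (zq; q)_n.
    have e1 : (1 - z * q) * rogersTerm q J (z * q) n =
        (-1) ^ (n + 1) * (z * q) ^ (2 * n + 2) * q ^ rogersExp (n + 1) *
          (1 - z * q ^ (2 * n + 3)) * (qPoch (z * q) q n * (1 - z * q ^ (n + 1))) * J (n + 1) := by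
      have := qPoch_succ' (z * q) q n
      rw [qPoch_succ] at this
      rw [rogersTerm]
      linear_combination (-((-1) ^ (n + 1) * (z * q) ^ (2 * n + 2) * q ^ rogersExp (n + 1) *
          (1 - z * q ^ (2 * n + 3)) * J (n + 1))) * this
    have e2 : (1 - z * q) * (1 - z * q ^ 2) * rogersTerm q J (z * q ^ 2) n =
        (-1) ^ (n + 1) * (z * q ^ 2) ^ (2 * n + 2) * q ^ rogersExp (n + 1) *
          (1 - z * q ^ (2 * n + 4)) * (qPoch (z * q) q n * (1 - z * q ^ (n + 1)) *
            (1 - z * q ^ (n + 2))) * J (n + 1) := by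
      have h1 := qPoch_succ' (z * q) q (n + 1)
      rw [qPoch_succ, qPoch_succ, qPoch_succ'] at h1
      rw [rogersTerm, show z * q ^ 2 * q = z * q * q * q by ring]
      linear_combination (-((-1) ^ (n + 1) * (z * q ^ 2) ^ (2 * n + 2) * q ^ rogersExp (n + 1) *
          (1 - z * q ^ (2 * n + 4)) * J (n + 1))) * h1
    have hs (w : S) : rogersSum q J w (n + 1) = rogersSum q J w n + rogersTerm q J w n := by
      simp only [rogersSum, sum_range_succ]; ring
    rw [hs, hs, hs, qPoch_succ]
    have e0 : rogersTerm q J z n = (-1) ^ (n + 1) * z ^ (2 * n + 2) * q ^ rogersExp (n + 1) *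
      (1 - z * q ^ (2 * n + 2)) * qPoch (z * q) q n * J (n + 1) := rfl
    have hJ := h.succ n
    have : rogersSum q J z n + rogersTerm q J z n -
        (1 - z * q) * (rogersSum q J (z * q) n + rogersTerm q J (z * q) n) -
        z * q * (1 - z * q) * (1 - z * q ^ 2) *
          (rogersSum q J (z * q ^ 2) n + rogersTerm q J (z * q ^ 2) n) =
        (-1) ^ n * z ^ (2 * n + 2) * q ^ (rogersExp n + 5 * n + 2) * qPoch (z * q) q n *
          ((1 - q ^ (n + 1)) * J (n + 1)) * (1 + q ^ (n + 1) - z * q ^ (2 * n + 2)) +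
        rogersTerm q J z n - (1 - z * q) * rogersTerm q J (z * q) n -
        z * q * ((1 - z * q) * (1 - z * q ^ 2) * rogersTerm q J (z * q ^ 2) n) := by
      rw [hJ, ← ih]; ring
    rw [this, e0, e1, e2]
    simp only [rogersExp]
    ring

/-- Partial sums of the Rogers–Ramanujan series `∑ q ^ (m² + i m) / (q; q)_m`. -/
def rrSum (q : S) (J : ℕ → S) (i n : ℕ) : S := ∑ m ∈ range n, q ^ (m * m + i * m) * J m

lemma rrSum_recurrence {q : S} {J : ℕ → S} (h : IsInvQFact q J) (i n : ℕ) :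
    rrSum q J i (n + 1) - rrSum q J (i + 1) (n + 1) = q ^ (i + 1) * rrSum q J (i + 2) n := by
  simp only [rrSum]
  rw [← sum_sub_distrib, sum_range_succ', mul_sum]
  simp only [mul_zero, add_zero, sub_self]
  refine sum_congr rfl fun m _ => ?_
  rw [← h.succ m]
  ring

end Rogers

/-! ### Nilpotent q: comparison of the two series -/

section Nilpotent

variable {S : Type*} [CommRing S] {q : S} {J : ℕ → S} {n : ℕ}

lemma rrSum_stable (hq : q ^ n = 0) (i : ℕ) : rrSum q J i (n + 1) = rrSum q J i n := by
  have : q ^ (n * n + i * n) = 0 :=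
    pow_eq_zero_of_le (le_add_right (Nat.le_mul_self n)) hq
  simp [rrSum, sum_range_succ, this]

/-- When q^n = 0 all factors from index n on are 1, so n factors already behave as the infinite
product. -/
lemma qPoch_stable (hq : q ^ n = 0) (i : ℕ) :
    qPoch (q ^ (i + 1)) q n = (1 - q ^ (i + 1)) * qPoch (q ^ (i + 2)) q n := by
  have h := qPoch_succ' (q ^ (i + 1)) q n
  rw [qPoch_succ, hq] at h
  rw [pow_succ q (i + 1), ← h]
  ring

/-- Both sides obey the same second-order recurrence in i and equal 1 as soon as q^i = 0, so
descending induction on i applies. -/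
lemma rrSum_mul_qPoch (h : IsInvQFact q J) (hq : q ^ n = 0) (i : ℕ) :
    rrSum q J i n * qPoch (q ^ (i + 1)) q n = rogersSum q J (q ^ i) n := by
  have hz {m : ℕ} (hm : n ≤ m) : q ^ m = 0 := pow_eq_zero_of_le hm hq
  rcases Nat.eq_zero_or_pos n with rfl | hn
  · exact (subsingleton_of_zero_eq_one (by simpa using hq.symm)).elim _ _
  have base {i : ℕ} (hi : n ≤ i) :
      rrSum q J i n * qPoch (q ^ (i + 1)) q n = rogersSum q J (q ^ i) n := by
    have h1 : rrSum q J i n = 1 := by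
      rw [rrSum, sum_eq_single_of_mem 0 (by simpa using hn)]
      · simp [h.zero]
      · intro m _ hm
        rw [hz, zero_mul]
        nlinarith [Nat.pos_of_ne_zero hm, Nat.zero_le (m * m)]
    have h2 : qPoch (q ^ (i + 1)) q n = 1 := by
      rw [hz (by omega)]; simp [qPoch]
    rw [h1, h2, hz hi, rogersSum]
    simp [rogersTerm]
  -- The induction variable d bounds the distance from i up to n.
  suffices H : ∀ d i, n ≤ i + d →
      rrSum q J i n * qPoch (q ^ (i + 1)) q n = rogersSum q J (q ^ i) n from H n i (by omega)
  intro d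
  induction d using Nat.strong_induction_on with
  | _ d ih =>
    intro i hi
    by_cases hin : n ≤ i
    · exact base hin
    have i1 := ih (d - 1) (by omega) (i + 1) (by omega)
    have i2 : rrSum q J (i + 2) n * qPoch (q ^ (i + 3)) q n = rogersSum q J (q ^ (i + 2)) n := by
      exact ih (d - 1) (by omega) (i + 2) (by omega)
    have hr := rrSum_recurrence h i n
    rw [rrSum_stable hq, rrSum_stable hq] at hr
    have hk := rogersSum_recurrence h (q ^ i) n
    rw [hz (show n ≤ rogersExp n + 5 * n + 2 by omega), ← pow_succ, ← pow_add] at hk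
    have s1 := qPoch_stable hq i
    have s2 : qPoch (q ^ (i + 2)) q n = (1 - q ^ (i + 2)) * qPoch (q ^ (i + 3)) q n :=
      qPoch_stable hq (i + 1)
    rw [← i1, ← i2] at hk
    rw [show i + 1 + 1 = i + 2 by rfl] at hk
    rw [← sub_eq_zero]
    rw [s2] at hk s1
    rw [s1]
    linear_combination (1 - q ^ (i + 1)) * (1 - q ^ (i + 2)) * qPoch (q ^ (i + 3)) q n * hr - hk

end Nilpotent
end RogersRamanujan

namespace RogersRamanujan

open Finset

/-! ### The q-binomial theorem and a finite Jacobi triple product -/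

section JacobiTriple

variable {S : Type*} [CommRing S]

/-- The q-binomial theorem, the Gaussian binomials being written with inverse factorials. The
induction is the q-Pascal rule, from 1 - p^(a+b) = (1 - p^b) + p^b (1 - p^a). -/
lemma prod_add_mul_pow {p : S} {J : ℕ → S} (h : IsInvQFact p J) (x y : S) (N : ℕ) :
    ∏ k ∈ range N, (y + x * p ^ k) = qPoch p p N *
      ∑ ab ∈ antidiagonal N, p ^ (ab.1.choose 2) * x ^ ab.1 * y ^ ab.2 * J ab.1 * J ab.2 := by
  induction N with
  | zero => simp [qPoch_zero, h.zero]
  | succ N ih =>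
    rw [prod_range_succ, ih, qPoch_succ, mul_assoc, mul_assoc]
    congr 1
    have split : (1 - p * p ^ N) * ∑ ab ∈ antidiagonal (N + 1),
          p ^ (ab.1.choose 2) * x ^ ab.1 * y ^ ab.2 * J ab.1 * J ab.2 =
        ∑ ab ∈ antidiagonal (N + 1), p ^ (ab.1.choose 2) * x ^ ab.1 * y ^ ab.2 * J ab.1 *
          ((1 - p ^ ab.2) * J ab.2) +
        ∑ ab ∈ antidiagonal (N + 1), p ^ (ab.1.choose 2) * x ^ ab.1 * y ^ ab.2 * p ^ ab.2 *
          ((1 - p ^ ab.1) * J ab.1) * J ab.2 := by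
      rw [mul_sum, ← sum_add_distrib]
      refine sum_congr rfl fun ab hab => ?_
      have : p * p ^ N = p ^ ab.1 * p ^ ab.2 := by
        rw [← pow_add, mem_antidiagonal.mp hab]; ring
      rw [this]
      ring
    rw [split, Nat.sum_antidiagonal_succ', Nat.sum_antidiagonal_succ]
    simp only [pow_zero, sub_self, zero_mul, mul_zero, zero_add, h.succ]
    rw [mul_comm, add_mul, mul_sum, mul_sum]
    congr 1
    · exact sum_congr rfl fun ab _ => by ring
    · refine sum_congr rfl fun ab hab => ?_
      rw [Nat.choose_succ_succ', Nat.choose_one_right, ← mem_antidiagonal.mp hab]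
      ring

/-- The exponents `s (5 s + 3) / 2`. -/
def thetaExp : ℕ → ℕ
  | 0 => 0
  | s + 1 => thetaExp s + 5 * s + 4

lemma le_thetaExp (s : ℕ) : s ≤ thetaExp s := by
  induction s with
  | zero => simp
  | succ s ih => simp only [thetaExp]; omega

lemma two_mul_thetaExp (s : ℕ) : 2 * thetaExp s = 5 * s * s + 3 * s := by
  induction s with
  | zero => simp [thetaExp]
  | succ s ih => simp only [thetaExp]; linarith

lemma two_mul_choose_two (s : ℕ) : 2 * s.choose 2 + s = s * s := by
  induction s with
  | zero => simp
  | succ s ih => rw [Nat.choose_succ_succ', Nat.choose_one_right]; linarith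

/-- A finite form of the Jacobi triple product identity in base `q ^ 5`. -/
lemma finite_jacobi [IsDomain S] {q : S} (hq : q ≠ 0) {J : ℕ → S} (h : IsInvQFact (q ^ 5) J)
    (n : ℕ) :
    qPoch q (q ^ 5) (n + 1) * qPoch (q ^ 4) (q ^ 5) (n + 1) =
      qPoch (q ^ 5) (q ^ 5) (2 * (n + 1)) *
        (∑ s ∈ range (n + 2), (-1) ^ s * q ^ thetaExp s * J (n + 1 + s) * J (n + 1 - s) -
          ∑ s ∈ range (n + 1), (-1) ^ s * q ^ (thetaExp s + 2 * s + 1) * J (n - s) *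
            J (n + 2 + s)) := by
  -- With y = q^(5n+1), the first n+1 factors y - q^(5k) yield (q; q⁵)_(n+1) and the last n+1 yield
  -- (q⁴; q⁵)_(n+1), up to signs and powers of q.
  have key := prod_add_mul_pow h (-1) (q ^ (5 * n + 1)) ((n + 1) + (n + 1))
  set e := 5 * (n + 1).choose 2 + (n + 1) * (5 * n + 1) with he
  have hc : 2 * (n + 1).choose 2 + (n + 1) = (n + 1) * (n + 1) := two_mul_choose_two _
  have lhs : ∏ k ∈ range ((n + 1) + (n + 1)), (q ^ (5 * n + 1) + -1 * (q ^ 5) ^ k) =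
      (-1) ^ (n + 1) * q ^ e * (qPoch q (q ^ 5) (n + 1) * qPoch (q ^ 4) (q ^ 5) (n + 1)) := by
    rw [prod_range_add]
    have a1 : ∏ k ∈ range (n + 1), (q ^ (5 * n + 1) + -1 * (q ^ 5) ^ k) =
        (-1) ^ (n + 1) * q ^ (5 * (n + 1).choose 2) * qPoch q (q ^ 5) (n + 1) := by
      have : ∀ k ∈ range (n + 1), (q ^ (5 * n + 1) + -1 * (q ^ 5) ^ k) =
          (-1) * (q ^ 5) ^ k * (1 - q * (q ^ 5) ^ (n + 1 - 1 - k)) := by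
        intro k hk
        obtain ⟨d, rfl⟩ := Nat.exists_eq_add_of_le (Nat.lt_succ_iff.mp (mem_range.mp hk))
        rw [show k + d + 1 - 1 - k = d by omega]
        ring
      rw [prod_congr rfl this, prod_mul_distrib, prod_mul_distrib, prod_const, card_range,
        prod_range_reflect (fun k => 1 - q * (q ^ 5) ^ k) (n + 1), prod_pow_eq_pow_sum,
        sum_range_id, ← Nat.choose_two_right, ← pow_mul, qPoch]
    have a2 : ∏ k ∈ range (n + 1), (q ^ (5 * n + 1) + -1 * (q ^ 5) ^ (n + 1 + k)) =
        q ^ ((n + 1) * (5 * n + 1)) * qPoch (q ^ 4) (q ^ 5) (n + 1) := by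
      have : ∀ k ∈ range (n + 1), (q ^ (5 * n + 1) + -1 * (q ^ 5) ^ (n + 1 + k)) =
          q ^ (5 * n + 1) * (1 - q ^ 4 * (q ^ 5) ^ k) := fun k _ => by ring
      rw [prod_congr rfl this, prod_mul_distrib, prod_const, card_range, ← pow_mul,
        mul_comm (5 * n + 1), qPoch]
    rw [a1, a2, he]
    ring
  have rhs : ∑ ab ∈ antidiagonal ((n + 1) + (n + 1)),
        (q ^ 5) ^ (ab.1.choose 2) * (-1) ^ ab.1 * (q ^ (5 * n + 1)) ^ ab.2 * J ab.1 * J ab.2 =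
      (-1) ^ (n + 1) * q ^ e *
        (∑ s ∈ range (n + 2), (-1) ^ s * q ^ thetaExp s * J (n + 1 + s) * J (n + 1 - s) -
          ∑ s ∈ range (n + 1), (-1) ^ s * q ^ (thetaExp s + 2 * s + 1) * J (n - s) *
            J (n + 2 + s)) := by
    -- The sum is cut in the middle: a = n + 1 + s above, and a = n - s, reversed, below.
    rw [Nat.sum_antidiagonal_eq_sum_range_succ
      (fun a b => (q ^ 5) ^ (a.choose 2) * (-1) ^ a * (q ^ (5 * n + 1)) ^ b * J a * J b),
      show (n + 1 + (n + 1)).succ = (n + 1) + (n + 2) by omega, sum_range_add, add_comm, mul_sub,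
      mul_sum, mul_sum, sub_eq_add_neg, ← sum_neg_distrib]
    congr 1
    · refine sum_congr rfl fun s hs => ?_
      obtain ⟨d, hd⟩ := Nat.exists_eq_add_of_le (Nat.lt_succ_iff.mp (mem_range.mp hs))
      rw [show n + 1 + (n + 1) - (n + 1 + s) = d by omega, show n + 1 - s = d by omega,
        ← pow_mul, ← pow_mul]
      have : q ^ (5 * (n + 1 + s).choose 2) * q ^ ((5 * n + 1) * d) = q ^ e * q ^ thetaExp s := by
        rw [← pow_add, ← pow_add]
        congr 1
        have h1 := two_mul_choose_two (n + 1 + s)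
        have h2 := two_mul_thetaExp s
        have : 2 * (5 * (n + 1 + s).choose 2 + (5 * n + 1) * d) = 2 * (e + thetaExp s) := by
          rw [he]
          zify at *
          have hn : (d : ℤ) = n + 1 - s := by linarith
          rw [hn]
          linear_combination 5 * h1 - 5 * hc - h2
        omega
      rw [pow_add (-1 : S) (n + 1) s]
      linear_combination (-1) ^ (n + 1) * (-1) ^ s * J (n + 1 + s) * J d * this
    · rw [← sum_range_reflect]
      refine sum_congr rfl fun s hs => ?_
      obtain ⟨d, hd⟩ := Nat.exists_eq_add_of_le (Nat.lt_succ_iff.mp (mem_range.mp hs))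
      rw [show n + 1 - 1 - s = d by omega, show n + 1 + (n + 1) - d = n + 2 + s by omega,
        show n - s = d by omega, ← pow_mul, ← pow_mul]
      have : q ^ (5 * d.choose 2) * q ^ ((5 * n + 1) * (n + 2 + s)) =
          q ^ e * q ^ (thetaExp s + 2 * s + 1) := by
        rw [← pow_add, ← pow_add]
        congr 1
        have h1 := two_mul_choose_two d
        have h2 := two_mul_thetaExp s
        have : 2 * (5 * d.choose 2 + (5 * n + 1) * (n + 2 + s)) =
            2 * (e + (thetaExp s + 2 * s + 1)) := by
          rw [he]
          zify at *
          have hn : (d : ℤ) = n - s := by linarith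
          rw [hn] at h1
          linear_combination 5 * h1 - 5 * hc - h2
        omega
      have sg : (-1 : S) ^ d = -((-1) ^ (n + 1) * (-1) ^ s) := by
        rw [hd, show s + d + 1 = d + (s + 1) by ring, pow_add, mul_assoc, ← pow_add,
          show s + 1 + s = 2 * s + 1 by ring, pow_succ, pow_mul]
        simp
      rw [sg]
      linear_combination (-((-1) ^ (n + 1) * (-1) ^ s * J (n + 2 + s) * J d)) * this
  rw [lhs, rhs] at key
  -- Cancelling q^e is what needs a domain and q ≠ 0; the nilpotent case is reached later by mapping
  -- to a quotient.
  have hne : (-1 : S) ^ (n + 1) * q ^ e ≠ 0 :=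
    mul_ne_zero (pow_ne_zero _ (neg_ne_zero.mpr one_ne_zero)) (pow_ne_zero _ hq)
  refine mul_left_cancel₀ hne ?_
  rw [key, ← two_mul]
  ring

end JacobiTriple
end RogersRamanujan

namespace RogersRamanujan

open Finset

/-! ### Passage to the limit and the second Rogers–Ramanujan identity -/

section Limit

variable {S : Type*} [CommRing S] {q : S}

lemma pow_mul_qPoch_stable {N : ℕ} (hq : q ^ N = 0) {e b m : ℕ} (hbm : b ≤ m)
    (he : N ≤ e + 5 * (b + 1)) :
    q ^ e * qPoch (q ^ 5) (q ^ 5) m = q ^ e * qPoch (q ^ 5) (q ^ 5) b := by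
  induction m, hbm using Nat.le_induction with
  | base => rfl
  | succ m hm ih =>
    have : q ^ (e + 5 * (m + 1)) = 0 := pow_eq_zero_of_le (by omega) hq
    rw [qPoch_succ, ← ih]
    linear_combination (-qPoch (q ^ 5) (q ^ 5) m) * this

/-- Once multiplied by q^e, factorials of length at least b are indistinguishable, so the two
products cancel against the two inverses. Gaussian binomials thus become 1 in the limit. -/
lemma pow_mul_qPoch_mul_inv {N : ℕ} (hq : q ^ N = 0) {J : ℕ → S} (h : IsInvQFact (q ^ 5) J)
    {e a b m M : ℕ} (hba : b ≤ a) (hbm : b ≤ m) (hbM : b ≤ M) (he : N ≤ e + 5 * (b + 1)) :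
    q ^ e * (qPoch (q ^ 5) (q ^ 5) M * qPoch (q ^ 5) (q ^ 5) m * J a * J b) = q ^ e := by
  have hM := pow_mul_qPoch_stable hq hbM he
  have hm := pow_mul_qPoch_stable hq hbm he
  have ha := pow_mul_qPoch_stable hq hba he
  have ia := h.qPoch_mul a
  have ib := h.qPoch_mul b
  linear_combination qPoch (q ^ 5) (q ^ 5) m * J a * J b * hM +
    qPoch (q ^ 5) (q ^ 5) b * J a * J b * hm - qPoch (q ^ 5) (q ^ 5) b * J a * J b * ha +
    q ^ e * ia + q ^ e * qPoch (q ^ 5) (q ^ 5) a * J a * ib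

/-- The conclusion of `finite_jacobi`. -/
def FiniteJacobi (q : S) (J : ℕ → S) (n : ℕ) : Prop :=
  qPoch q (q ^ 5) (n + 1) * qPoch (q ^ 4) (q ^ 5) (n + 1) =
      qPoch (q ^ 5) (q ^ 5) (2 * (n + 1)) *
        (∑ s ∈ range (n + 2), (-1) ^ s * q ^ thetaExp s * J (n + 1 + s) * J (n + 1 - s) -
          ∑ s ∈ range (n + 1), (-1) ^ s * q ^ (thetaExp s + 2 * s + 1) * J (n - s) *
            J (n + 2 + s))

lemma FiniteJacobi.limit {J : ℕ → S} {n : ℕ} (jac : FiniteJacobi q J n)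
    (h : IsInvQFact (q ^ 5) J) (hq : q ^ (n + 1) = 0) :
    qPoch q (q ^ 5) (n + 1) * qPoch (q ^ 4) (q ^ 5) (n + 1) * qPoch (q ^ 5) (q ^ 5) (n + 1) =
      ∑ s ∈ range (n + 1), (-1) ^ s * q ^ thetaExp s * (1 - q ^ (2 * s + 1)) := by
  have hz : q ^ thetaExp (n + 1) = 0 := pow_eq_zero_of_le (le_thetaExp _) hq
  rw [FiniteJacobi, sum_range_succ _ (n + 1), hz] at jac
  simp only [mul_zero, zero_mul, add_zero] at jac
  rw [jac, ← sum_sub_distrib, mul_sum, sum_mul]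
  refine sum_congr rfl fun s hs => ?_
  have hs' := mem_range.mp hs
  have hle := le_thetaExp s
  have h1 := pow_mul_qPoch_mul_inv hq h (e := thetaExp s) (a := n + 1 + s) (b := n + 1 - s)
    (m := n + 1) (M := 2 * (n + 1)) (by omega) (by omega) (by omega) (by omega)
  have h2 := pow_mul_qPoch_mul_inv hq h (e := thetaExp s + 2 * s + 1) (a := n + 2 + s)
    (b := n - s) (m := n + 1) (M := 2 * (n + 1)) (by omega) (by omega) (by omega) (by omega)
  linear_combination (-1) ^ s * h1 - (-1) ^ s * h2

lemma thetaExp_eq (s : ℕ) : thetaExp s = rogersExp s + 2 * s := by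
  induction s with
  | zero => rfl
  | succ s ih => simp only [thetaExp, rogersExp]; omega

/-- At z = q, (1 - q)(q²; q)_s = (q; q)_(s+1) cancels `J (s + 1)`. -/
lemma one_sub_mul_rogersSum {J : ℕ → S} (h : IsInvQFact q J) (n : ℕ) :
    (1 - q) * rogersSum q J q n =
      ∑ s ∈ range (n + 1), (-1) ^ s * q ^ thetaExp s * (1 - q ^ (2 * s + 1)) := by
  rw [sum_range_succ', rogersSum, mul_add, mul_sum, add_comm]
  congr 1
  · refine sum_congr rfl fun s _ => ?_
    have h1 := h.qPoch_mul (s + 1)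
    rw [qPoch_succ'] at h1
    rw [rogersTerm, thetaExp_eq]
    linear_combination (-1) ^ (s + 1) * q ^ (2 * s + 2) * q ^ rogersExp (s + 1) *
      (1 - q ^ (2 * s + 3)) * h1
  · simp [thetaExp]

lemma qPoch_five_mul (q : S) (m : ℕ) :
    qPoch q q (5 * m) = qPoch q (q ^ 5) m * qPoch (q ^ 4) (q ^ 5) m * qPoch (q ^ 5) (q ^ 5) m *
      (qPoch (q ^ 2) (q ^ 5) m * qPoch (q ^ 3) (q ^ 5) m) := by
  induction m with
  | zero => simp [qPoch_zero]
  | succ m ih =>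
    rw [show 5 * (m + 1) = 5 * m + 1 + 1 + 1 + 1 + 1 by ring]
    simp only [qPoch_succ]
    rw [ih]
    ring

lemma qPoch_self_stable {n m : ℕ} (hq : q ^ n = 0) (hm : n ≤ m) : qPoch q q m = qPoch q q n := by
  induction m, hm using Nat.le_induction with
  | base => rfl
  | succ m hm ih => rw [qPoch_succ, ih, pow_eq_zero_of_le hm hq]; ring

/-- The second Rogers–Ramanujan identity modulo `q ^ (n + 1)`. -/
lemma rrSum_mul_eq_one {J J₅ : ℕ → S} {n : ℕ} (jac : FiniteJacobi q J₅ n)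
    (h₅ : IsInvQFact (q ^ 5) J₅) (h : IsInvQFact q J) (hq : q ^ (n + 1) = 0) :
    rrSum q J 1 (n + 1) * (qPoch (q ^ 2) (q ^ 5) (n + 1) * qPoch (q ^ 3) (q ^ 5) (n + 1)) = 1 := by
  have h1 := rrSum_mul_qPoch h hq 1
  rw [pow_one] at h1
  have hq' : q ^ thetaExp (n + 1) = 0 := pow_eq_zero_of_le (le_thetaExp _) hq
  have h2 := one_sub_mul_rogersSum h (n + 1)
  rw [sum_range_succ _ (n + 1), hq', mul_zero, zero_mul, add_zero, ← jac.limit h₅ hq, ← h1] at h2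
  have h3 := qPoch_succ' q q (n + 1)
  rw [← pow_two, show (q ^ 2) = q ^ (1 + 1) by rfl,
    qPoch_self_stable hq (Nat.le_succ _),
    ← qPoch_self_stable hq (show n + 1 ≤ 5 * (n + 1) by omega)] at h3
  have h4 := h.qPoch_mul (5 * (n + 1))
  have h5 := qPoch_five_mul q (n + 1)
  -- The three products divide the invertible (q; q)_(5(n+1)); what remains after cancelling them is
  -- the product over residues 2 and 3.
  have hu : IsUnit (qPoch q (q ^ 5) (n + 1) * qPoch (q ^ 4) (q ^ 5) (n + 1) *
      qPoch (q ^ 5) (q ^ 5) (n + 1)) :=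
    isUnit_of_mul_isUnit_left (h5 ▸ IsUnit.of_mul_eq_one _ h4)
  refine hu.mul_left_cancel ?_
  linear_combination h2 - rrSum q J 1 (n + 1) * h5 + rrSum q J 1 (n + 1) * h3

end Limit

/-! ### Transfer to power series -/

section PowerSeries

open PowerSeries

lemma constantCoeff_qPoch {p : ℚ⟦X⟧} (hp : constantCoeff p = 0) (n : ℕ) :
    constantCoeff (qPoch p p n) = 1 := by
  simp [qPoch, map_prod, hp]

lemma isInvQFact_inv {p : ℚ⟦X⟧} (hp : constantCoeff p = 0) :
    IsInvQFact p fun n => (qPoch p p n)⁻¹ where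
  zero := by simp [qPoch_zero]
  succ n := by
    have h1 : constantCoeff (1 - p * p ^ n) ≠ 0 := by simp [hp]
    rw [qPoch_succ, PowerSeries.mul_inv_rev, ← mul_assoc, pow_succ', PowerSeries.mul_inv_cancel _ h1,
      one_mul]

lemma map_qPoch {R T : Type*} [CommRing R] [CommRing T] (f : R →+* T) (a p : R) (n : ℕ) :
    f (qPoch a p n) = qPoch (f a) (f p) n := by
  simp [qPoch, map_prod]

lemma IsInvQFact.map {R T : Type*} [CommRing R] [CommRing T] (f : R →+* T) {p : R} {J : ℕ → R}
    (h : IsInvQFact p J) : IsInvQFact (f p) fun n => f (J n) where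
  zero := by simp [h.zero]
  succ n := by simpa using congrArg f (h.succ n)

/-- The second Rogers–Ramanujan identity as a congruence of power series. -/
theorem X_pow_dvd_rrSum_mul_sub_one (n : ℕ) :
    (X : ℚ⟦X⟧) ^ (n + 1) ∣ rrSum X (fun m => (qPoch (X : ℚ⟦X⟧) X m)⁻¹) 1 (n + 1) *
      (qPoch (X ^ 2) (X ^ 5) (n + 1) * qPoch (X ^ 3) (X ^ 5) (n + 1)) - 1 := by
  rw [← Ideal.mem_span_singleton, ← Ideal.Quotient.eq]
  set f := Ideal.Quotient.mk (Ideal.span {(X : ℚ⟦X⟧) ^ (n + 1)})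
  have h := (isInvQFact_inv (p := (X : ℚ⟦X⟧)) (by simp)).map f
  have h₅' := isInvQFact_inv (p := (X : ℚ⟦X⟧) ^ 5) (by simp)
  have h₅ := h₅'.map f
  rw [map_pow] at h₅
  have hq : (f X) ^ (n + 1) = 0 := by
    rw [← map_pow]
    exact Ideal.Quotient.eq_zero_iff_mem.mpr (Ideal.mem_span_singleton_self _)
  -- The finite identity is proved in the domain ℚ⟦X⟧ and only then reduced modulo X^(n+1).
  have jac : FiniteJacobi (f X) (fun m => f ((qPoch (X ^ 5 : ℚ⟦X⟧) (X ^ 5) m)⁻¹)) n := by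
    have := congrArg f (finite_jacobi (X_ne_zero (R := ℚ)) h₅' n)
    simpa only [FiniteJacobi, map_mul, map_sub, map_sum, map_pow, map_neg, map_one, map_qPoch] using this
  have := rrSum_mul_eq_one jac h₅ h hq
  simpa only [rrSum, map_mul, map_sum, map_pow, map_one, map_qPoch] using this

end PowerSeries
end RogersRamanujan

namespace RogersRamanujan

open Finset

/-! ### Multisets with prescribed multiplicities -/

section MultisetCount

open PowerSeries Classical in
/-- The generating function `∑ X ^ (i c)` over the admissible multiplicities `c ∈ C` of a
part `i`. -/
noncomputable def multGF (i : ℕ) (C : Set ℕ) : ℚ⟦X⟧ :=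
  PowerSeries.mk fun n => if i ∣ n ∧ n / i ∈ C then 1 else 0

/-- Multisets of sum `n` with parts in `T` whose multiplicities are prescribed by `C`. -/
def IsPrescribed (T : Finset ℕ) (C : ℕ → Set ℕ) (n : ℕ) (c : Multiset ℕ) : Prop :=
  (∀ x ∈ c, x ∈ T) ∧ c.sum = n ∧ ∀ i ∈ T, c.count i ∈ C i

lemma sum_eq_sum_count {T : Finset ℕ} {c : Multiset ℕ} (hc : ∀ x ∈ c, x ∈ T) :
    c.sum = ∑ i ∈ T, i * c.count i := by
  rw [Finset.sum_multiset_count_of_subset c T fun x hx => hc x (Multiset.mem_toFinset.mp hx)]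
  exact sum_congr rfl fun i _ => by rw [smul_eq_mul, mul_comm]

lemma count_sum_replicate (T : Finset ℕ) (g : ℕ → ℕ) (i : ℕ) :
    (∑ t ∈ T, Multiset.replicate (g t) t).count i = if i ∈ T then g i else 0 := by
  rw [Multiset.count_sum']
  simp [Multiset.count_replicate]

open Classical in
-- A multiset corresponds to the splitting of n into the amounts i · count i contributed by each
-- part size, which are the terms in the coefficient of a product.
theorem card_isPrescribed {T : Finset ℕ} (hT : 0 ∉ T) (C : ℕ → Set ℕ) (n : ℕ) :
    (Nat.card {c : Multiset ℕ // IsPrescribed T C n c} : ℚ) =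
      PowerSeries.coeff n (∏ i ∈ T, multGF i (C i)) := by
  rw [PowerSeries.coeff_prod]
  simp only [multGF, PowerSeries.coeff_mk, Finset.prod_ite_zero, prod_const_one]
  rw [sum_boole]
  norm_cast
  rw [← Nat.card_eq_finsetCard]
  have hpos {i : ℕ} (hi : i ∈ T) : 0 < i := Nat.pos_of_ne_zero fun h => hT (h ▸ hi)
  refine Nat.card_congr
    { toFun := fun c => ⟨Finsupp.onFinset T (fun i => i * c.1.count i) fun i hi =>
          c.2.1 i (Multiset.count_ne_zero.mp (right_ne_zero_of_mul hi)), ?_⟩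
      invFun := fun g => ⟨∑ t ∈ T, Multiset.replicate (g.1 t / t) t, ?_⟩
      left_inv := ?_
      right_inv := ?_ }
  · obtain ⟨c, h1, h2, h3⟩ := c
    rw [mem_filter, mem_finsuppAntidiag]
    refine ⟨⟨?_, Finsupp.support_onFinset_subset⟩, fun i hi => ?_⟩
    · simp only [Finsupp.onFinset_apply]
      exact (sum_eq_sum_count h1).symm.trans h2
    · simp only [Finsupp.onFinset_apply, Nat.mul_div_cancel_left _ (hpos hi)]
      exact ⟨dvd_mul_right _ _, h3 i hi⟩
  · obtain ⟨g, hg⟩ := g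
    rw [mem_filter, mem_finsuppAntidiag] at hg
    have hmem : ∀ x ∈ ∑ t ∈ T, Multiset.replicate (g t / t) t, x ∈ T := by
      intro x hx
      by_contra hxT
      rw [← Multiset.count_pos, count_sum_replicate, if_neg hxT] at hx
      exact hx.ne rfl
    refine ⟨hmem, ?_, fun i hi => ?_⟩
    · rw [sum_eq_sum_count hmem, ← hg.1.1]
      refine sum_congr rfl fun i hi => ?_
      rw [count_sum_replicate, if_pos hi, Nat.mul_div_cancel' (hg.2 i hi).1]
    · rw [count_sum_replicate, if_pos hi]
      exact (hg.2 i hi).2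
  · rintro ⟨c, h1, h2, h3⟩
    ext i
    simp only [Finsupp.onFinset_apply]
    rw [count_sum_replicate]
    split_ifs with hi
    · exact Nat.mul_div_cancel_left _ (hpos hi)
    · exact (Multiset.count_eq_zero.mpr fun h => hi (h1 i h)).symm
  · rintro ⟨g, hg⟩
    rw [mem_filter, mem_finsuppAntidiag] at hg
    ext i
    simp only [Finsupp.onFinset_apply]
    rw [count_sum_replicate]
    split_ifs with hi
    · exact Nat.mul_div_cancel' (hg.2 i hi).1
    · rw [mul_zero]
      exact (Finsupp.notMem_support_iff.mp fun h => hi (hg.1.2 h)).symm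

lemma coeff_multGF_mul {i : ℕ} (hi : 0 < i) (C : Set ℕ) (c : ℕ) :
    PowerSeries.coeff (i * c) (multGF i C) = C.indicator 1 c := by
  classical
  rw [multGF, PowerSeries.coeff_mk, Set.indicator_apply, Nat.mul_div_cancel_left _ hi]
  exact if_congr (and_iff_right (dvd_mul_right _ _)) rfl rfl

lemma coeff_multGF_of_not_dvd {i n : ℕ} (h : ¬ i ∣ n) (C : Set ℕ) :
    PowerSeries.coeff n (multGF i C) = 0 := by
  rw [multGF, PowerSeries.coeff_mk]
  exact if_neg fun h' => h h'.1

lemma multGF_empty (i : ℕ) : multGF i ∅ = 0 := by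
  ext n; simp [multGF]

open PowerSeries in
lemma multGF_insert {i a : ℕ} (hi : 0 < i) {C : Set ℕ} (ha : a ∉ C) :
    multGF i (insert a C) = X ^ (i * a) + multGF i C := by
  ext n
  rw [map_add, coeff_X_pow]
  by_cases hd : i ∣ n
  · obtain ⟨c, rfl⟩ := hd
    rw [coeff_multGF_mul hi, coeff_multGF_mul hi]
    by_cases hc : c = a
    · subst hc; simp [ha]
    · classical simp [hc, hi.ne', Set.indicator_apply]
  · have : n ≠ i * a := fun h => hd ⟨a, h⟩
    simp [coeff_multGF_of_not_dvd hd, this]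

open PowerSeries in
lemma multGF_singleton {i : ℕ} (hi : 0 < i) (a : ℕ) : multGF i {a} = X ^ (i * a) := by
  rw [← insert_empty_eq, multGF_insert hi (Set.notMem_empty a), multGF_empty, add_zero]

open PowerSeries in
/-- Multiplicities `c` with `⌊c / d⌋ = l` amount to `l` parts equal to `i d` together with fewer
than `d` parts equal to `i`. -/
lemma one_sub_mul_multGF_Ico {i : ℕ} (hi : 0 < i) (a d : ℕ) :
    (1 - X ^ i) * multGF i (Set.Ico a (a + d)) = X ^ (i * a) * (1 - X ^ (i * d)) := by
  induction d with
  | zero => simp [multGF_empty]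
  | succ d ih =>
    have : Set.Ico a (a + (d + 1)) = insert (a + d) (Set.Ico a (a + d)) := by
      ext x; simp only [Set.mem_Ico, Set.mem_insert_iff]; omega
    rw [this, multGF_insert hi (by simp), mul_add, ih]
    ring

open PowerSeries in
lemma one_sub_mul_multGF_univ {i : ℕ} (hi : 0 < i) :
    (1 - X ^ i) * multGF i Set.univ = 1 := by
  ext n
  rw [sub_mul, one_mul, map_sub, coeff_X_pow_mul', coeff_one]
  by_cases hd : i ∣ n
  · obtain ⟨c, rfl⟩ := hd
    rcases c with _ | c
    · simpa [hi.ne'] using coeff_multGF_mul hi Set.univ 0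
    · rw [coeff_multGF_mul hi, show i * (c + 1) - i = i * c by rw [mul_add]; simp,
        coeff_multGF_mul hi]
      simp [hi.ne', Nat.le_mul_of_pos_right]
  · have hn : n ≠ 0 := fun h => hd (h ▸ dvd_zero i)
    have hd' : i ≤ n → ¬ i ∣ n - i := fun h h' => hd ((Nat.dvd_sub_self_right.mp h').resolve_right
      fun h'' => hd (by rw [le_antisymm h'' h]))
    split_ifs with h
    · simp [coeff_multGF_of_not_dvd hd, coeff_multGF_of_not_dvd (hd' h)]
    · simp [coeff_multGF_of_not_dvd hd]

end MultisetCount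
end RogersRamanujan

namespace RogersRamanujan

/-! ### Removing the staircase 2, 4, …, 2m -/

section Lists

/-- Subtract `2, 4, 6, …` from the entries of a list, starting from its end. -/
def reduceList : List ℕ → List ℕ
  | [] => []
  | a :: l => (a - 2 * (l.length + 1)) :: reduceList l

/-- Add `2, 4, 6, …` to the entries of a list, starting from its end. -/
def expandList : List ℕ → List ℕ
  | [] => []
  | a :: l => (a + 2 * (l.length + 1)) :: expandList l

@[simp] lemma length_reduceList (l : List ℕ) : (reduceList l).length = l.length := by
  induction l with
  | nil => rfl
  | cons a l ih => simp [reduceList, ih]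

@[simp] lemma length_expandList (l : List ℕ) : (expandList l).length = l.length := by
  induction l with
  | nil => rfl
  | cons a l ih => simp [expandList, ih]

lemma mapIdx_eq_reduceList (l : List ℕ) :
    l.mapIdx (fun i a => a - 2 * (l.length - i)) = reduceList l := by
  induction l with
  | nil => rfl
  | cons a l ih =>
    rw [List.mapIdx_cons, reduceList, ← ih]
    simp

/-- The lists of parts of the members of `Diff₂^*`. -/
def IsStarList (l : List ℕ) : Prop := l.IsChain (fun a b => b + 2 ≤ a) ∧ ∀ x ∈ l, 2 ≤ x

lemma IsStarList.tail {a : ℕ} {l : List ℕ} (h : IsStarList (a :: l)) : IsStarList l :=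
  ⟨h.1.tail, fun x hx => h.2 x (List.mem_cons_of_mem _ hx)⟩

/-- Guarantees that the natural subtraction in `reduceList` never truncates, so it can be undone. -/
lemma IsStarList.le_head {a : ℕ} {l : List ℕ} (h : IsStarList (a :: l)) :
    2 * (l.length + 1) ≤ a := by
  induction l generalizing a with
  | nil => simpa using h.2 a (by simp)
  | cons b l ih =>
    have := ih h.tail
    have h2 := (List.isChain_cons_cons.mp h.1).1
    simp only [List.length_cons]
    omega

lemma expandList_reduceList {l : List ℕ} (h : IsStarList l) : expandList (reduceList l) = l := by
  induction l with
  | nil => rfl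
  | cons a l ih =>
    have := h.le_head
    rw [reduceList, expandList, ih h.tail, length_reduceList, Nat.sub_add_cancel this]

lemma reduceList_expandList (l : List ℕ) : reduceList (expandList l) = l := by
  induction l with
  | nil => rfl
  | cons a l ih => simp [reduceList, expandList, ih]

lemma IsStarList.pairwise_reduceList {l : List ℕ} (h : IsStarList l) :
    (reduceList l).Pairwise (· ≥ ·) := by
  rw [← List.isChain_iff_pairwise]
  induction l with
  | nil => exact List.isChain_nil
  | cons a l ih =>
    cases l with
    | nil => exact List.isChain_singleton _
    | cons b l =>
      have h2 := (List.isChain_cons_cons.mp h.1).1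
      refine List.isChain_cons_cons.mpr ⟨?_, ih h.tail⟩
      simp only [List.length_cons]
      omega

lemma isStarList_expandList {l : List ℕ} (h : l.Pairwise (· ≥ ·)) :
    IsStarList (expandList l) := by
  induction l with
  | nil => exact ⟨List.isChain_nil, by simp [expandList]⟩
  | cons a l ih =>
    obtain ⟨h1, h2⟩ := List.pairwise_cons.mp h
    obtain ⟨i1, i2⟩ := ih h2
    refine ⟨?_, ?_⟩
    · cases l with
      | nil => exact List.isChain_singleton _
      | cons b l =>
        refine List.isChain_cons_cons.mpr ⟨?_, i1⟩
        have := h1 b (by simp)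
        simp only [List.length_cons]
        omega
    · intro x hx
      rcases List.mem_cons.mp hx with rfl | hx
      · omega
      · exact i2 x hx

lemma sum_expandList (l : List ℕ) :
    (expandList l).sum = l.sum + l.length * (l.length + 1) := by
  induction l with
  | nil => rfl
  | cons a l ih =>
    rw [expandList, List.sum_cons, ih, List.sum_cons, List.length_cons]
    ring

lemma IsStarList.pairwise {l : List ℕ} (h : IsStarList l) : l.Pairwise (· ≥ ·) := by
  rw [← List.isChain_iff_pairwise]
  exact h.1.imp fun a b hab => by omega

end Lists

/-! ### Conjugation -/

section Columns

/-- In a decreasing list the rows longer than c form an initial segment; both sides say that cell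
(i, c) lies in the diagram. The default 0 stands for rows beyond the list. -/
lemma lt_countP_iff {l : List ℕ} (h : l.Pairwise (· ≥ ·)) (i c : ℕ) :
    i < l.countP (fun r => c < r) ↔ c < l.getD i 0 := by
  induction l generalizing i with
  | nil => simp
  | cons a l ih =>
    obtain ⟨h1, h2⟩ := List.pairwise_cons.mp h
    by_cases hca : c < a
    · rw [List.countP_cons_of_pos (by simpa using hca)]
      cases i with
      | zero => simp [hca]
      | succ i => simpa using ih h2 i
    · have h0 : (a :: l).countP (fun r => c < r) = 0 := by
        rw [List.countP_eq_zero]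
        intro x hx
        rcases List.mem_cons.mp hx with rfl | hx
        · simpa using hca
        · have := h1 x hx
          simp only [decide_eq_true_eq]
          omega
      rw [h0]
      refine iff_of_false (by simp) ?_
      cases i with
      | zero => simpa using hca
      | succ i =>
        intro hc
        rw [List.getD_cons_succ, ← ih h2] at hc
        rw [List.countP_eq_zero] at h0
        have := List.countP_eq_zero.mpr fun x hx => h0 x (List.mem_cons_of_mem a hx)
        omega

lemma le_foldr_max {l : List ℕ} {x : ℕ} (hx : x ∈ l) : x ≤ l.foldr max 0 := by
  induction l with
  | nil => simp at hx
  | cons a l ih =>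
    rcases List.mem_cons.mp hx with rfl | hx
    · simp
    · exact (ih hx).trans (by simp)

lemma getD_le_foldr_max (l : List ℕ) (i : ℕ) : l.getD i 0 ≤ l.foldr max 0 := by
  by_cases hi : i < l.length
  · rw [List.getD_eq_getElem _ _ hi]
    exact le_foldr_max (List.getElem_mem hi)
  · rw [List.getD_eq_default _ _ (by omega)]
    exact Nat.zero_le _

lemma exists_lt_of_lt_foldr_max {l : List ℕ} {c : ℕ} (hc : c < l.foldr max 0) :
    ∃ r ∈ l, c < r := by
  induction l with
  | nil => simp at hc
  | cons a l ih =>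
    rw [List.foldr_cons, lt_max_iff] at hc
    rcases hc with hc | hc
    · exact ⟨a, by simp, hc⟩
    · obtain ⟨r, hr, h⟩ := ih hc
      exact ⟨r, List.mem_cons_of_mem _ hr, h⟩

lemma countP_lt_columns {l : List ℕ} (h : l.Pairwise (· ≥ ·)) (i : ℕ) :
    (columns l).countP (fun x => i < x) = l.getD i 0 := by
  rw [columns, Multiset.countP_map]
  simp only [lt_countP_iff h]
  have : (Multiset.range (l.foldr max 0)).filter (fun c => c < l.getD i 0) =
      Multiset.range (l.getD i 0) := by
    refine (Multiset.Nodup.ext ((Multiset.nodup_range _).filter _) (Multiset.nodup_range _)).mpr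
      fun c => ?_
    have := getD_le_foldr_max l i
    simp only [Multiset.mem_filter, Multiset.mem_range]
    omega
  rw [this, Multiset.card_range]

lemma mem_columns {l : List ℕ} {x : ℕ} (hx : x ∈ columns l) : 0 < x ∧ x ≤ l.length := by
  rw [columns, Multiset.mem_map] at hx
  obtain ⟨c, hc, rfl⟩ := hx
  obtain ⟨r, hr, h⟩ := exists_lt_of_lt_foldr_max (Multiset.mem_range.mp hc)
  exact ⟨List.countP_pos_iff.mpr ⟨r, hr, by simpa using h⟩, List.countP_le_length⟩

lemma sum_range_countP (l : List ℕ) (M : ℕ) (hM : ∀ x ∈ l, x ≤ M) :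
    ∑ c ∈ Finset.range M, l.countP (fun r => c < r) = l.sum := by
  induction l with
  | nil => simp
  | cons a l ih =>
    simp only [List.countP_cons, Finset.sum_add_distrib, List.sum_cons]
    rw [ih fun x hx => hM x (List.mem_cons_of_mem _ hx), add_comm]
    congr 1
    have : (Finset.range M).filter (fun c => c < a) = Finset.range a := by
      have := hM a (by simp)
      ext c
      simp only [Finset.mem_filter, Finset.mem_range]
      omega
    simp [Finset.sum_boole, this]

lemma sum_columns (l : List ℕ) : (columns l).sum = l.sum :=
  sum_range_countP l _ fun _ hx => le_foldr_max hx

/-- Successive differences of the tail counts give the multiplicities of the positive entries. -/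
lemma eq_of_countP_lt_eq {s t : Multiset ℕ} (hs : ∀ x ∈ s, 0 < x) (ht : ∀ x ∈ t, 0 < x)
    (h : ∀ i, s.countP (fun x => i < x) = t.countP (fun x => i < x)) : s = t := by
  have key (u : Multiset ℕ) (x : ℕ) :
      u.countP (fun y => x < y) = u.count (x + 1) + u.countP (fun y => x + 1 < y) := by
    induction u using Multiset.induction_on with
    | empty => simp
    | cons a u ih =>
      rw [Multiset.countP_cons, Multiset.countP_cons, Multiset.count_cons, ih]
      split_ifs <;> omega
  ext x
  cases x with
  | zero =>
    rw [Multiset.count_eq_zero.mpr fun h => (hs 0 h).ne rfl,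
      Multiset.count_eq_zero.mpr fun h => (ht 0 h).ne rfl]
  | succ x =>
    have := key s x
    have := key t x
    have := h x
    have := h (x + 1)
    omega

/-- The weakly decreasing list of length `m` whose columns form a given multiset. -/
def rowsOf (m : ℕ) (c : Multiset ℕ) : List ℕ :=
  (List.range m).map fun i => c.countP (fun x => i < x)

lemma pairwise_rowsOf (m : ℕ) (c : Multiset ℕ) : (rowsOf m c).Pairwise (· ≥ ·) := by
  rw [rowsOf, List.pairwise_map]
  refine List.pairwise_lt_range.imp fun {a b} hab => ?_
  simp only [Multiset.countP_eq_card_filter]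
  exact Multiset.card_le_card (Multiset.monotone_filter_right _ fun x hx => hab.trans hx)

lemma getD_rowsOf {m : ℕ} {c : Multiset ℕ} (hc : ∀ x ∈ c, x ≤ m) (i : ℕ) :
    (rowsOf m c).getD i 0 = c.countP (fun x => i < x) := by
  by_cases hi : i < m
  · simp [rowsOf, hi]
  · rw [List.getD_eq_default _ _ (by simpa [rowsOf] using hi), eq_comm, Multiset.countP_eq_zero]
    intro x hx
    have := hc x hx
    omega

lemma columns_rowsOf {m : ℕ} {c : Multiset ℕ} (hc : ∀ x ∈ c, 0 < x ∧ x ≤ m) :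
    columns (rowsOf m c) = c :=
  eq_of_countP_lt_eq (fun _ hx => (mem_columns hx).1) (fun x hx => (hc x hx).1) fun i => by
    rw [countP_lt_columns (pairwise_rowsOf m c), getD_rowsOf fun x hx => (hc x hx).2]

end Columns

/-! ### The bijection `col^*` -/

section Bijection

lemma IsDiffTwoStar.isStarList {N : ℕ} {lam : N.Partition} (h : IsDiffTwoStar lam) :
    IsStarList (rowList lam) := by
  refine ⟨h.1, fun x hx => ?_⟩
  have hx' : x ∈ lam.parts := by simpa [rowList] using hx
  have h0 := lam.parts_pos hx'
  have h1 : x ≠ 1 := fun h1 => h.2 (h1 ▸ hx')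
  omega

lemma reducedRows_eq {N : ℕ} (lam : N.Partition) :
    reducedRows lam = reduceList (rowList lam) := mapIdx_eq_reduceList _

lemma length_rowList {N : ℕ} (lam : N.Partition) :
    (rowList lam).length = lam.parts.card := Multiset.length_sort _

lemma coe_rowList {N : ℕ} (lam : N.Partition) : (rowList lam : Multiset ℕ) = lam.parts :=
  Multiset.sort_eq _ _

/-- Members of `Diff₂^*` with `m` parts correspond under `col^*` to the multisets of parts between
`1` and `m`. -/
theorem card_isDiffTwoStar (N m : ℕ) (P : Multiset ℕ → Prop) :
    Nat.card {lam : N.Partition // IsDiffTwoStar lam ∧ lam.parts.card = m ∧ P (colStar lam)} =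
      Nat.card {c : Multiset ℕ // (∀ x ∈ c, 0 < x ∧ x ≤ m) ∧ c.sum + m * (m + 1) = N ∧ P c} := by
  refine Nat.card_congr (Equiv.ofBijective
    (fun lam => ⟨colStar lam.1, ?_, ?_, lam.2.2.2⟩) ⟨?_, ?_⟩)
  · obtain ⟨lam, h, hm, hP⟩ := lam
    intro x hx
    have := mem_columns hx
    rwa [reducedRows_eq, length_reduceList, length_rowList, hm] at this
  · obtain ⟨lam, h, hm, hP⟩ := lam
    simp only
    have h1 := sum_expandList (reduceList (rowList lam))
    rw [expandList_reduceList h.isStarList, length_reduceList, length_rowList, hm] at h1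
    rw [colStar, sum_columns, reducedRows_eq, ← h1, ← Multiset.sum_coe, coe_rowList, lam.parts_sum]
  · rintro ⟨lam, h, hm, hP⟩ ⟨lam', h', hm', hP'⟩ heq
    have heq : colStar lam = colStar lam' := congrArg Subtype.val heq
    -- Columns forget rows of length 0: the common m restores the length, and `countP_lt_columns`
    -- the entries.
    have hlist : reduceList (rowList lam) = reduceList (rowList lam') := by
      refine List.ext_getElem (by simp [length_rowList, hm, hm']) fun i hi hi' => ?_
      rw [← List.getD_eq_getElem _ 0, ← List.getD_eq_getElem _ 0,
        ← countP_lt_columns h.isStarList.pairwise_reduceList,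
        ← countP_lt_columns h'.isStarList.pairwise_reduceList, ← reducedRows_eq, ← reducedRows_eq]
      exact congrArg _ heq
    have hrow := congrArg expandList hlist
    rw [expandList_reduceList h.isStarList, expandList_reduceList h'.isStarList] at hrow
    refine Subtype.ext (Nat.Partition.ext ?_)
    exact (coe_rowList lam).symm.trans (hrow ▸ coe_rowList lam')
  · rintro ⟨c, hc, hsum, hP⟩
    have hstar := isStarList_expandList (pairwise_rowsOf m c)
    let lam : N.Partition :=
      { parts := expandList (rowsOf m c)
        parts_pos := fun {i} hi => by
          have := hstar.2 i (by simpa using hi)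
          omega
        parts_sum := by
          rw [Multiset.sum_coe, sum_expandList, ← sum_columns, columns_rowsOf hc, ← hsum]
          simp [rowsOf] }
    have hrow : rowList lam = expandList (rowsOf m c) :=
      List.Perm.eq_of_pairwise' (Multiset.pairwise_sort _ _) hstar.pairwise
        (Multiset.coe_eq_coe.mp (coe_rowList lam))
    have hcol : colStar lam = c := by
      rw [colStar, reducedRows_eq, hrow, reduceList_expandList, columns_rowsOf hc]
    refine ⟨⟨lam, ⟨?_, ?_⟩, ?_, ?_⟩, Subtype.ext hcol⟩
    · rw [IsDiffTwo, hrow]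
      exact hstar.1
    · intro h1
      have := hstar.2 1 (by simpa [lam] using h1)
      omega
    · simp [lam, rowsOf]
    · rwa [hcol]

end Bijection
end RogersRamanujan

namespace RogersRamanujan

open Finset PowerSeries

/-! ### Generating functions for the multiplicities of 2, 3 and 7 -/

section Prescribed

lemma prod_one_sub_mul_multGF {T U : Finset ℕ} (hT : 0 ∉ T) (hU : U ⊆ T) (C : ℕ → Set ℕ)
    (hC : ∀ i ∈ T, i ∉ U → C i = Set.univ) :
    (∏ i ∈ T, (1 - X ^ i)) * ∏ i ∈ T, multGF i (C i) = ∏ i ∈ U, (1 - X ^ i) * multGF i (C i) := by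
  rw [← prod_mul_distrib]
  refine (prod_subset hU fun i hi hiU => ?_).symm
  rw [hC i hi hiU, one_sub_mul_multGF_univ (Nat.pos_of_ne_zero fun h => hT (h ▸ hi))]

/-- `k` twos, `j` threes and `l` sevens. -/
def mult237 (k j l i : ℕ) : Set ℕ :=
  if i = 2 then {k} else if i = 3 then {j} else if i = 7 then {l} else Set.univ

/-- `X ^ (2 k + 3 j + 7 l) (1 - X²) (1 - X³) (1 - X⁷)`. -/
noncomputable def weight (k j l : ℕ) : ℚ⟦X⟧ :=
  X ^ (2 * k + 3 * j + 7 * l) * (1 - X ^ 2) * (1 - X ^ 3) * (1 - X ^ 7)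

lemma prod_mult237 {T : Finset ℕ} (hT : 0 ∉ T) (hU : {2, 3, 7} ⊆ T) (k j l : ℕ) :
    (∏ i ∈ T, (1 - X ^ i)) * ∏ i ∈ T, multGF i (mult237 k j l i) = weight k j l := by
  rw [prod_one_sub_mul_multGF hT hU _ fun i _ hi => ?_]
  · rw [prod_insert (by simp), prod_insert (by simp), prod_singleton]
    simp only [mult237, if_true, if_false, Nat.reduceEqDiff]
    rw [multGF_singleton (by norm_num), multGF_singleton (by norm_num),
      multGF_singleton (by norm_num), weight]
    ring
  · simp only [mem_insert, mem_singleton, not_or] at hi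
    simp [mult237, hi]

end Prescribed

/-! ### Partitions into parts congruent to 2 or 3 modulo 5 -/

section ProductSide

/-- The integers below `5 L` congruent to `2` or `3` modulo `5`. -/
def residues (L : ℕ) : Finset ℕ := (range (5 * L)).filter fun i => i % 5 = 2 ∨ i % 5 = 3

lemma prod_residues (L : ℕ) :
    ∏ i ∈ residues L, (1 - (X : ℚ⟦X⟧) ^ i) =
      qPoch (X ^ 2) (X ^ 5) L * qPoch (X ^ 3) (X ^ 5) L := by
  rw [residues, prod_filter]
  induction L with
  | zero => simp [qPoch_zero]
  | succ L ih =>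
    rw [show 5 * (L + 1) = 5 * L + 1 + 1 + 1 + 1 + 1 by ring]
    simp only [prod_range_succ, ih, qPoch_succ]
    rw [if_neg (by omega), if_neg (by omega), if_pos (by omega), if_pos (by omega),
      if_neg (by omega)]
    ring

/-- The bound 5(N + 4) exceeds every part of a partition of N and keeps 2, 3, 7 among the allowed
parts even for small N. -/
lemma card_productSide_eq_isPrescribed (N k j l : ℕ) :
    Nat.card {mu : N.Partition //
        (∀ i ∈ mu.parts, i ≡ 2 [MOD 5] ∨ i ≡ 3 [MOD 5]) ∧
          mu.parts.count 2 = k ∧ mu.parts.count 3 = j ∧ mu.parts.count 7 = l} =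
      Nat.card {c : Multiset ℕ // IsPrescribed (residues (N + 4)) (mult237 k j l) N c} := by
  have key (c : Multiset ℕ) : (∀ i ∈ residues (N + 4), c.count i ∈ mult237 k j l i) ↔
      c.count 2 = k ∧ c.count 3 = j ∧ c.count 7 = l := by
    constructor
    · intro h
      have h2 := h 2 (by simp [residues]; omega)
      have h3 := h 3 (by simp [residues]; omega)
      have h7 := h 7 (by simp [residues]; omega)
      simpa [mult237] using And.intro h2 (And.intro h3 h7)
    · rintro ⟨rfl, rfl, rfl⟩ i -
      unfold mult237
      split_ifs <;> simp_all
  refine Nat.card_congr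
    { toFun := fun mu => ⟨mu.1.parts, fun i hi => ?_, mu.1.parts_sum, (key _).mpr mu.2.2⟩
      invFun := fun c => ⟨⟨c.1, fun {i} hi => ?_, c.2.2.1⟩, fun i hi => ?_, (key _).mp c.2.2.2⟩
      left_inv := fun _ => rfl
      right_inv := fun _ => rfl }
  · have h1 := mu.2.1 i hi
    have h2 := mu.1.le_of_mem_parts hi
    simp only [Nat.ModEq] at h1
    simp only [residues, mem_filter, mem_range]
    omega
  · have := c.2.1 i hi
    simp only [residues, mem_filter, mem_range] at this
    omega
  · have := c.2.1 i hi
    simp only [residues, mem_filter, mem_range] at this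
    exact this.2

/-- The inverses of the polynomials `(X; X)_m`. -/
noncomputable def invQFact (m : ℕ) : ℚ⟦X⟧ := (qPoch (X : ℚ⟦X⟧) X m)⁻¹

lemma card_productSide (N k j l : ℕ) :
    (Nat.card {mu : N.Partition //
        (∀ i ∈ mu.parts, i ≡ 2 [MOD 5] ∨ i ≡ 3 [MOD 5]) ∧
          mu.parts.count 2 = k ∧ mu.parts.count 3 = j ∧ mu.parts.count 7 = l} : ℚ) =
      coeff N (∑ m ∈ range (N + 4), X ^ (m * (m + 1)) * (invQFact m * weight k j l)) := by
  have h0 : 0 ∉ residues (N + 4) := by simp [residues]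
  rw [card_productSide_eq_isPrescribed, card_isPrescribed h0]
  have hW := prod_mult237 (T := residues (N + 4)) h0 (by
    intro i hi
    simp only [mem_insert, mem_singleton] at hi
    simp only [residues, mem_filter, mem_range]
    omega) k j l
  rw [prod_residues] at hW
  obtain ⟨r, hr⟩ := X_pow_dvd_rrSum_mul_sub_one (N + 3)
  set A := ∏ i ∈ residues (N + 4), multGF i (mult237 k j l i)
  have hsum : ∑ m ∈ range (N + 4), X ^ (m * (m + 1)) * (invQFact m * weight k j l) =
      rrSum X (fun m => (qPoch (X : ℚ⟦X⟧) X m)⁻¹) 1 (N + 4) * weight k j l := by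
    rw [rrSum, sum_mul]
    exact sum_congr rfl fun m _ => by rw [invQFact]; ring
  have : ∑ m ∈ range (N + 4), X ^ (m * (m + 1)) * (invQFact m * weight k j l) =
      A + X ^ (N + 4) * (r * A) := by
    rw [hsum, ← hW]
    linear_combination A * hr
  rw [this, map_add, coeff_X_pow_mul', if_neg (by omega), add_zero]

end ProductSide

/-! ### Partitions in `Diff₂^*`, by number of parts -/

section SumSide

/-- The conditions in `Admissible` on `col^*` for partitions with `m` parts. -/
def ColAdmissible (k j l m : ℕ) (c : Multiset ℕ) : Prop :=
  (7 ≤ m → c.count 2 = k ∧ c.count 3 = j ∧ c.count 7 = l) ∧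
  (4 ≤ m ∧ m ≤ 6 → c.count 2 = k ∧ c.count 3 = j ∧ 7 * l ≤ c.count 1 ∧ c.count 1 ≤ 7 * l + 6) ∧
  (m = 3 → c.count 2 = k ∧ c.count 3 = j ∧
      ((c.count 1 : ℤ) = 7 * (l : ℤ) ∨ (c.count 1 : ℤ) = 7 * (l : ℤ) + 1 ∨
       (c.count 1 : ℤ) = 7 * (l : ℤ) - 12 ∨ (c.count 1 : ℤ) = 7 * (l : ℤ) - 4 ∨
       (c.count 1 : ℤ) = 7 * (l : ℤ) + 4 ∨ (c.count 1 : ℤ) = 7 * (l : ℤ) + 5 ∨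
       (c.count 1 : ℤ) = 7 * (l : ℤ) + 6)) ∧
  (m = 2 → (l = 0 ∧ ((2 ≤ j ∧
        c = Multiset.replicate k 2 + Multiset.replicate (3 * (j - 2)) 1) ∨
      c = Multiset.replicate k 2 + Multiset.replicate (3 * j + 2) 1)) ∨
    (l = 1 ∧ c = Multiset.replicate k 2 + Multiset.replicate (3 * j + 1) 1)) ∧
  (m = 1 → (1 ≤ k ∧ j = 0 ∧ l = 0 ∧ c = Multiset.replicate (2 * k - 2) 1) ∨
    (j = 1 ∧ l = 0 ∧ c = Multiset.replicate (2 * k + 1) 1))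

/-- The multiplicities of `1` allowed for partitions with one part. -/
def onesOne (k j l : ℕ) : Set ℕ :=
  {a | (1 ≤ k ∧ j = 0 ∧ l = 0 ∧ a = 2 * k - 2) ∨ (j = 1 ∧ l = 0 ∧ a = 2 * k + 1)}

/-- The multiplicities of `1` allowed for partitions with two parts. -/
def onesTwo (j l : ℕ) : Set ℕ :=
  {a | (l = 0 ∧ ((2 ≤ j ∧ a = 3 * (j - 2)) ∨ a = 3 * j + 2)) ∨ (l = 1 ∧ a = 3 * j + 1)}

/-- The multiplicities of `1` allowed for partitions with three parts. -/
def onesThree (l : ℕ) : Set ℕ :=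
  {a | (a : ℤ) = 7 * (l : ℤ) ∨ (a : ℤ) = 7 * (l : ℤ) + 1 ∨ (a : ℤ) = 7 * (l : ℤ) - 12 ∨
    (a : ℤ) = 7 * (l : ℤ) - 4 ∨ (a : ℤ) = 7 * (l : ℤ) + 4 ∨ (a : ℤ) = 7 * (l : ℤ) + 5 ∨
    (a : ℤ) = 7 * (l : ℤ) + 6}

/-- Prescribed multiplicities of `1`, `2` and `3`. -/
def mult123 (A B C : Set ℕ) (i : ℕ) : Set ℕ :=
  if i = 1 then A else if i = 2 then B else if i = 3 then C else Set.univ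

/-- The multiplicities that `ColAdmissible` prescribes for partitions with `m` parts. -/
def colMult (k j l m : ℕ) : ℕ → Set ℕ :=
  if m = 1 then mult123 (onesOne k j l) ∅ ∅
  else if m = 2 then mult123 (onesTwo j l) {k} ∅
  else if m = 3 then mult123 (onesThree l) {k} {j}
  else if m ≤ 6 then mult123 (Set.Ico (7 * l) (7 * l + 7)) {k} {j}
  else mult237 k j l

lemma eq_replicate_one_iff {c : Multiset ℕ} (hc : ∀ x ∈ c, 0 < x ∧ x ≤ 1) (a : ℕ) :
    c = Multiset.replicate a 1 ↔ c.count 1 = a := by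
  constructor
  · rintro rfl; simp
  · rintro rfl
    rw [eq_comm, ← Multiset.filter_eq', Multiset.filter_eq_self]
    intro x hx
    have := hc x hx
    omega

lemma eq_replicate_add_iff {c : Multiset ℕ} (hc : ∀ x ∈ c, 0 < x ∧ x ≤ 2) (k a : ℕ) :
    c = Multiset.replicate k 2 + Multiset.replicate a 1 ↔ c.count 1 = a ∧ c.count 2 = k := by
  constructor
  · rintro rfl; simp [Multiset.count_replicate]
  · rintro ⟨rfl, rfl⟩
    ext x
    rw [Multiset.count_add, Multiset.count_replicate, Multiset.count_replicate]
    by_cases hx : x ∈ c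
    · have := hc x hx
      obtain rfl | rfl : x = 1 ∨ x = 2 := by omega
      all_goals simp
    · rw [Multiset.count_eq_zero_of_notMem hx]
      split_ifs with h1 h2 h2
      · omega
      · subst h1; simp [hx]
      · subst h2; simp [hx]
      · rfl

/-- For m ≤ 2 every part is 1 or 2, so an equation for the whole multiset is also just a condition
on multiplicities. -/
lemma colAdmissible_iff {k j l m : ℕ} (hm : 1 ≤ m) {c : Multiset ℕ}
    (hc : ∀ x ∈ c, 0 < x ∧ x ≤ m) :
    ColAdmissible k j l m c ↔ ∀ i ∈ Icc 1 m, c.count i ∈ colMult k j l m i := by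
  have large (hm : 3 ≤ m) (A : Set ℕ) :
      (∀ i ∈ Icc 1 m, c.count i ∈ mult123 A {k} {j} i) ↔
        c.count 2 = k ∧ c.count 3 = j ∧ c.count 1 ∈ A := by
    constructor
    · intro h
      have h1 := h 1 (mem_Icc.mpr (by omega))
      have h2 := h 2 (mem_Icc.mpr (by omega))
      have h3 := h 3 (mem_Icc.mpr (by omega))
      simpa [mult123] using And.intro h2 (And.intro h3 h1)
    · rintro ⟨h2, h3, h1⟩ i -
      unfold mult123
      split_ifs <;> simp_all
  unfold ColAdmissible colMult
  split_ifs with h1 h2 h3 h6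
  · subst h1
    simp only [eq_replicate_one_iff hc]
    simp [mult123, onesOne]
  · subst h2
    rw [show Icc 1 2 = {1, 2} by rfl]
    simp only [eq_replicate_add_iff hc, mem_insert, mem_singleton, forall_eq_or_imp, forall_eq,
      mult123, onesTwo, Set.mem_ofPred_eq, if_true, if_false, Set.mem_singleton_iff,
      OfNat.ofNat_ne_one]
    norm_num
    tauto
  · subst h3
    rw [large le_rfl]
    simp [onesThree]
  · rw [large (by omega), Set.mem_Ico]
    omega
  · constructor
    · intro h i _
      obtain ⟨h2, h3, h7⟩ := h.1 (by omega)
      unfold mult237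
      split_ifs <;> simp_all
    · intro h
      have i2 := h 2 (mem_Icc.mpr (by omega))
      have i3 := h 3 (mem_Icc.mpr (by omega))
      have i7 := h 7 (mem_Icc.mpr (by omega))
      have : c.count 2 = k ∧ c.count 3 = j ∧ c.count 7 = l := by
        simpa [mult237] using And.intro i2 (And.intro i3 i7)
      exact ⟨fun _ => this, fun h => absurd h.2 h6, fun h => absurd h h3, fun h => absurd h h2,
        fun h => absurd h h1⟩

/-- The generating function of the admissible `col^*` of partitions with `m` parts. -/
noncomputable def colGF (k j l m : ℕ) : ℚ⟦X⟧ := ∏ i ∈ Icc 1 m, multGF i (colMult k j l m i)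

lemma card_colAdmissible {k j l m : ℕ} (hm : 1 ≤ m) (N : ℕ) :
    (Nat.card {c : Multiset ℕ // (∀ x ∈ c, 0 < x ∧ x ≤ m) ∧ c.sum + m * (m + 1) = N ∧
        ColAdmissible k j l m c} : ℚ) = coeff N (X ^ (m * (m + 1)) * colGF k j l m) := by
  rw [coeff_X_pow_mul', colGF]
  split_ifs with h
  · rw [← card_isPrescribed (by simp)]
    congr 1
    refine Nat.card_congr (Equiv.subtypeEquivRight fun c => ?_)
    unfold IsPrescribed
    constructor
    · rintro ⟨h1, h2, h3⟩
      exact ⟨fun x hx => mem_Icc.mpr (h1 x hx), by omega, (colAdmissible_iff hm h1).mp h3⟩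
    · rintro ⟨h1, h2, h3⟩
      have h1 : ∀ x ∈ c, 0 < x ∧ x ≤ m := fun x hx => mem_Icc.mp (h1 x hx)
      exact ⟨h1, by omega, (colAdmissible_iff hm h1).mpr h3⟩
  · have : IsEmpty {c : Multiset ℕ // (∀ x ∈ c, 0 < x ∧ x ≤ m) ∧ c.sum + m * (m + 1) = N ∧
        ColAdmissible k j l m c} := ⟨fun c => h (by have := c.2.2.1; omega)⟩
    rw [Nat.card_of_isEmpty, Nat.cast_zero]

lemma card_sumSide {N : ℕ} (hN : 1 ≤ N) (k j l : ℕ) :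
    (Nat.card {lam : N.Partition // IsDiffTwoStar lam ∧ Admissible k j l lam} : ℚ) =
      coeff N (∑ m ∈ Icc 1 (N + 3), X ^ (m * (m + 1)) * colGF k j l m) := by
  classical
  rw [map_sum]
  have : Nat.card {lam : N.Partition // IsDiffTwoStar lam ∧ Admissible k j l lam} =
      ∑ m ∈ Icc 1 (N + 3), Nat.card {lam : N.Partition //
        IsDiffTwoStar lam ∧ lam.parts.card = m ∧ ColAdmissible k j l m (colStar lam)} := by
    simp only [Nat.card_eq_fintype_card, Fintype.card_subtype]
    rw [card_eq_sum_card_fiberwise (f := fun lam : N.Partition => lam.parts.card)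
      (t := Icc 1 (N + 3))]
    · refine sum_congr rfl fun m _ => ?_
      congr 1
      ext lam
      simp only [mem_filter, mem_univ, true_and]
      constructor
      · rintro ⟨⟨h1, h2⟩, rfl⟩
        exact ⟨h1, rfl, h2⟩
      · rintro ⟨h1, rfl, h2⟩
        exact ⟨⟨h1, h2⟩, rfl⟩
    · intro lam _
      have h1 : lam.parts.card ≤ N := by
        have := Multiset.card_nsmul_le_sum (s := lam.parts) (a := 1) fun x hx => lam.parts_pos hx
        rwa [lam.parts_sum, smul_eq_mul, mul_one] at this
      -- `Admissible` is vacuous for the empty partition, which N ≥ 1 rules out.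
      have h2 : lam.parts.card ≠ 0 := by
        intro h
        have := lam.parts_sum
        rw [Multiset.card_eq_zero.mp h, Multiset.sum_zero] at this
        omega
      simp only [coe_Icc, Set.mem_Icc]
      omega
  rw [this, Nat.cast_sum]
  refine sum_congr rfl fun m hm => ?_
  rw [card_isDiffTwoStar, card_colAdmissible (mem_Icc.mp hm).1]

end SumSide
end RogersRamanujan

namespace RogersRamanujan

open Finset PowerSeries

/-! ### Comparison of the two generating functions -/

section Comparison

lemma qPoch_self_eq_prod_Icc (m : ℕ) :
    qPoch (X : ℚ⟦X⟧) X m = ∏ i ∈ Icc 1 m, (1 - X ^ i) := by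
  induction m with
  | zero => simp [qPoch_zero]
  | succ m ih => rw [qPoch_succ, prod_Icc_succ_top (by omega), ih, pow_succ']

lemma invQFact_mul_qPoch (m : ℕ) : invQFact m * qPoch X X m = 1 :=
  PowerSeries.inv_mul_cancel _ (by rw [constantCoeff_qPoch (by simp)]; exact one_ne_zero)

lemma colGF_eq_of_four_le {k j l m : ℕ} (hm : 4 ≤ m) :
    colGF k j l m = invQFact m * weight k j l := by
  suffices h : qPoch X X m * colGF k j l m = weight k j l by
    rw [← h, ← mul_assoc, invQFact_mul_qPoch, one_mul]
  rw [qPoch_self_eq_prod_Icc, colGF]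
  by_cases h6 : m ≤ 6
  · have : colMult k j l m = mult123 (Set.Ico (7 * l) (7 * l + 7)) {k} {j} := by
      rw [colMult, if_neg (by omega), if_neg (by omega), if_neg (by omega), if_pos h6]
    rw [this, prod_one_sub_mul_multGF (U := {1, 2, 3}) (by simp) ?_ _ fun i _ hi => ?_]
    · rw [prod_insert (by simp), prod_insert (by simp), prod_singleton]
      simp only [mult123, if_true, if_false, Nat.reduceEqDiff, OfNat.ofNat_ne_one]
      rw [one_sub_mul_multGF_Ico one_pos, multGF_singleton (by norm_num),
        multGF_singleton (by norm_num), weight]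
      ring
    · intro i hi
      simp only [mem_insert, mem_singleton] at hi
      rw [mem_Icc]
      omega
    · simp only [mem_insert, mem_singleton, not_or] at hi
      simp [mult123, hi]
  · have : colMult k j l m = mult237 k j l := by
      rw [colMult, if_neg (by omega), if_neg (by omega), if_neg (by omega), if_neg h6]
    rw [this]
    refine prod_mult237 (by simp) ?_ k j l
    intro i hi
    simp only [mem_insert, mem_singleton] at hi
    rw [mem_Icc]
    omega

lemma invQFact_zero : invQFact 0 = 1 := by simp [invQFact, qPoch_zero]

lemma invQFact_succ (m : ℕ) : (1 - X ^ (m + 1)) * invQFact (m + 1) = invQFact m :=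
  (isInvQFact_inv (p := (X : ℚ⟦X⟧)) (by simp)).succ m

lemma colGF_one (k j l : ℕ) : colGF k j l 1 = multGF 1 (onesOne k j l) := by
  simp [colGF, colMult, mult123]

lemma colGF_two (k j l : ℕ) : colGF k j l 2 = multGF 1 (onesTwo j l) * X ^ (2 * k) := by
  rw [colGF, show Icc 1 2 = {1, 2} by rfl, prod_pair (by norm_num)]
  simp [colMult, mult123, multGF_singleton]

lemma colGF_three (k j l : ℕ) :
    colGF k j l 3 = multGF 1 (onesThree l) * X ^ (2 * k) * X ^ (3 * j) := by
  rw [colGF, show Icc 1 3 = {1, 2, 3} by rfl, prod_insert (by simp), prod_pair (by norm_num)]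
  simp [colMult, mult123, multGF_singleton, mul_assoc]

/-- For m ≤ 3 the weight is divisible by (X; X)_m, so the terms to be compared are explicit
polynomials. -/
lemma weight_mul_invQFact_one (k j l : ℕ) :
    invQFact 1 * weight k j l =
      X ^ (2 * k + 3 * j + 7 * l) * (1 + X) * (1 - X ^ 3) * (1 - X ^ 7) := by
  have h := invQFact_succ 0
  rw [invQFact_zero] at h
  rw [weight]
  linear_combination X ^ (2 * k + 3 * j + 7 * l) * (1 + X) * (1 - X ^ 3) * (1 - X ^ 7) * h

lemma weight_mul_invQFact_two (k j l : ℕ) :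
    invQFact 2 * weight k j l =
      X ^ (2 * k + 3 * j + 7 * l) * (1 + X + X ^ 2) * (1 - X ^ 7) := by
  have h0 := invQFact_succ 0
  have h1 := invQFact_succ 1
  rw [invQFact_zero] at h0
  rw [weight]
  linear_combination X ^ (2 * k + 3 * j + 7 * l) * (1 + X + X ^ 2) * (1 - X ^ 7) *
    (h0 + (1 - X) * h1)

lemma weight_mul_invQFact_three (k j l : ℕ) :
    invQFact 3 * weight k j l = X ^ (2 * k + 3 * j + 7 * l) *
      (1 + X + X ^ 2 + X ^ 3 + X ^ 4 + X ^ 5 + X ^ 6) := by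
  have h0 := invQFact_succ 0
  have h1 := invQFact_succ 1
  have h2 := invQFact_succ 2
  rw [invQFact_zero] at h0
  rw [weight]
  linear_combination X ^ (2 * k + 3 * j + 7 * l) *
    (1 + X + X ^ 2 + X ^ 3 + X ^ 4 + X ^ 5 + X ^ 6) *
    (h0 + (1 - X) * h1 + (1 - X) * (1 - X ^ 2) * h2)

/-- The values 7l - 4 and 7l - 12 are multiplicities only from l = 1 and l = 2 on, whence three
cases. -/
lemma multGF_onesThree_zero : multGF 1 (onesThree 0) = 1 + X + X ^ 4 + X ^ 5 + X ^ 6 := by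
  have : onesThree 0 = {0, 1, 4, 5, 6} := by
    ext a
    simp only [onesThree, Set.mem_ofPred_eq, Set.mem_insert_iff, Set.mem_singleton_iff]
    omega
  rw [this]
  iterate 4 rw [multGF_insert one_pos (by simp)]
  rw [multGF_singleton one_pos]
  ring

lemma multGF_onesThree_one :
    multGF 1 (onesThree 1) = X ^ 7 * (1 + X + X ^ 4 + X ^ 5 + X ^ 6) + X ^ 3 := by
  have : onesThree 1 = {7, 8, 3, 11, 12, 13} := by
    ext a
    simp only [onesThree, Set.mem_ofPred_eq, Set.mem_insert_iff, Set.mem_singleton_iff]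
    omega
  rw [this]
  iterate 5 rw [multGF_insert one_pos (by simp)]
  rw [multGF_singleton one_pos]
  ring

lemma multGF_onesThree_add_two (l : ℕ) : multGF 1 (onesThree (l + 2)) =
    X ^ (7 * l) * (X ^ 14 * (1 + X + X ^ 4 + X ^ 5 + X ^ 6) + X ^ 10 + X ^ 2) := by
  have : onesThree (l + 2) = {7 * l + 14, 7 * l + 15, 7 * l + 2, 7 * l + 10, 7 * l + 18,
      7 * l + 19, 7 * l + 20} := by
    ext a
    simp only [onesThree, Set.mem_ofPred_eq, Set.mem_insert_iff, Set.mem_singleton_iff]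
    omega
  rw [this]
  iterate 6 rw [multGF_insert one_pos (by simp)]
  rw [multGF_singleton one_pos]
  ring

lemma multGF_onesTwo_zero {j : ℕ} (hj : j < 2) : multGF 1 (onesTwo j 0) = X ^ (3 * j + 2) := by
  have : onesTwo j 0 = {3 * j + 2} := by
    ext a
    simp only [onesTwo, true_and, Set.mem_ofPred_eq, Set.mem_singleton_iff]
    grind
  rw [this, multGF_singleton one_pos, one_mul]

lemma multGF_onesTwo_zero_add_two (j : ℕ) :
    multGF 1 (onesTwo (j + 2) 0) = X ^ (3 * j) * (1 + X ^ 8) := by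
  have : onesTwo (j + 2) 0 = {3 * j, 3 * j + 8} := by
    ext a
    simp only [onesTwo, true_and, Set.mem_ofPred_eq, Set.mem_insert_iff, Set.mem_singleton_iff]
    grind
  rw [this, multGF_insert one_pos (by simp), multGF_singleton one_pos]
  ring

lemma multGF_onesTwo_one (j : ℕ) : multGF 1 (onesTwo j 1) = X ^ (3 * j + 1) := by
  have : onesTwo j 1 = {3 * j + 1} := by
    ext a
    simp only [onesTwo, true_and, Set.mem_ofPred_eq, Set.mem_singleton_iff]
    grind
  rw [this, multGF_singleton one_pos, one_mul]

lemma multGF_onesTwo_add_two (j l : ℕ) : multGF 1 (onesTwo j (l + 2)) = 0 := by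
  have : onesTwo j (l + 2) = ∅ := by
    ext a
    simp only [onesTwo, iff_false, Set.mem_ofPred_eq, Set.mem_empty_iff_false]
    grind
  rw [this, multGF_empty]

lemma multGF_onesOne_of_empty {k j l : ℕ} (h : 1 ≤ l ∨ 2 ≤ j ∨ (k = 0 ∧ j = 0)) :
    multGF 1 (onesOne k j l) = 0 := by
  have : onesOne k j l = ∅ := by
    ext a
    simp only [onesOne, iff_false, Set.mem_ofPred_eq, Set.mem_empty_iff_false]
    grind
  rw [this, multGF_empty]

lemma multGF_onesOne_zero (k : ℕ) : multGF 1 (onesOne (k + 1) 0 0) = X ^ (2 * k) := by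
  have : onesOne (k + 1) 0 0 = {2 * k} := by
    ext a
    simp only [onesOne, true_and, Set.mem_ofPred_eq, Set.mem_singleton_iff]
    grind
  rw [this, multGF_singleton one_pos, one_mul]

lemma multGF_onesOne_one (k : ℕ) : multGF 1 (onesOne k 1 0) = X ^ (2 * k + 1) := by
  have : onesOne k 1 0 = {2 * k + 1} := by
    ext a
    simp only [onesOne, true_and, Set.mem_ofPred_eq, Set.mem_singleton_iff]
    grind
  rw [this, multGF_singleton one_pos, one_mul]

/-- The polynomial identity comparing the contributions of at most three parts. -/
lemma small_parts_identity (k j l : ℕ) :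
    weight k j l + X ^ 2 * (invQFact 1 * weight k j l) + X ^ 6 * (invQFact 2 * weight k j l) +
        X ^ 12 * (invQFact 3 * weight k j l) =
      X ^ 2 * colGF k j l 1 + X ^ 6 * colGF k j l 2 + X ^ 12 * colGF k j l 3 +
        if k = 0 ∧ j = 0 ∧ l = 0 then 1 else 0 := by
  rw [weight_mul_invQFact_one, weight_mul_invQFact_two, weight_mul_invQFact_three, weight,
    colGF_one, colGF_two, colGF_three]
  -- The splits at l = 0, 1, j = 0, 1 and k = 0 are where a prescribed multiplicity appears or
  -- disappears; in each case the identity is one of polynomials.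
  match l with
  | 0 =>
    rw [multGF_onesThree_zero]
    match j with
    | 0 =>
      rw [multGF_onesTwo_zero (by norm_num)]
      match k with
      | 0 =>
        rw [multGF_onesOne_of_empty (by omega), if_pos (by simp)]
        ring
      | k + 1 =>
        rw [multGF_onesOne_zero, if_neg (by simp)]
        ring
    | 1 =>
      rw [multGF_onesTwo_zero (by norm_num), multGF_onesOne_one, if_neg (by simp)]
      ring
    | j + 2 =>
      rw [multGF_onesTwo_zero_add_two, multGF_onesOne_of_empty (by omega), if_neg (by simp)]
      ring
  | 1 =>
    rw [multGF_onesThree_one, multGF_onesTwo_one, multGF_onesOne_of_empty (by omega),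
      if_neg (by simp)]
    ring
  | l + 2 =>
    rw [multGF_onesThree_add_two, multGF_onesTwo_add_two, multGF_onesOne_of_empty (by omega),
      if_neg (by simp)]
    ring

lemma sum_range_eq_sum_Icc (k j l M : ℕ) :
    ∑ m ∈ range (M + 4), X ^ (m * (m + 1)) * (invQFact m * weight k j l) =
      ∑ m ∈ Icc 1 (M + 3), X ^ (m * (m + 1)) * colGF k j l m +
        if k = 0 ∧ j = 0 ∧ l = 0 then 1 else 0 := by
  induction M with
  | zero =>
    have h := small_parts_identity k j l
    -- The four terms m = 0, …, 3 must be compared together; each later m matches separately.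
    rw [show Icc 1 (0 + 3) = {1, 2, 3} by rfl, sum_insert (by simp), sum_pair (by norm_num)]
    simp only [zero_add, sum_range_succ, sum_range_zero, invQFact_zero]
    norm_num only at h ⊢
    linear_combination h
  | succ M ih =>
    rw [show M + 1 + 4 = (M + 4) + 1 by ring, sum_range_succ, ih, show M + 1 + 3 = (M + 3) + 1 by
      ring, sum_Icc_succ_top (b := M + 3) (by omega), colGF_eq_of_four_le (show 4 ≤ M + 3 + 1 by omega)]
    ring

end Comparison
end RogersRamanujan

theorem mainTheorem10 (N k j l : ℕ) (hN : 1 ≤ N) :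
    Nat.card {mu : N.Partition //
        (∀ i ∈ mu.parts, i ≡ 2 [MOD 5] ∨ i ≡ 3 [MOD 5]) ∧
          mu.parts.count 2 = k ∧ mu.parts.count 3 = j ∧ mu.parts.count 7 = l} =
      Nat.card {lam : N.Partition //
        RogersRamanujan.IsDiffTwoStar lam ∧ RogersRamanujan.Admissible k j l lam} := by
  have h := RogersRamanujan.card_productSide N k j l
  -- The leftover constant is the m = 0 contribution of the empty partition, invisible in degree N ≥
  -- 1.
  have h0 : PowerSeries.coeff N (if k = 0 ∧ j = 0 ∧ l = 0 then (1 : PowerSeries ℚ) else 0) = 0 := by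
    split_ifs
    · rw [PowerSeries.coeff_one, if_neg (by omega)]
    · exact map_zero _
  rw [RogersRamanujan.sum_range_eq_sum_Icc, map_add, h0, add_zero,
    ← RogersRamanujan.card_sumSide hN] at h
  exact_mod_cast h
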